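/- Let $C>0$, $\alpha\in(0,1]$ and $a,A,K>0$. There is a constant $c>0$, depending only on $C,\alpha,a,A,K$, such that the following holds. Let $(\mathcal M,d)$ be a complete, uniquely geodesic metric space (every two points $p,q$ are joined by exactly one geodesic $\gamma_p^q:[0,d(p,q)]\to\mathcal M$). For $u,q\ne p$ let $\angle_p(u,q)$ be the Alexandrov angle at $p$ between $\gamma_p^u$ and $\gamma_p^q$, that is $$\angle_p(u,q)=\lim_{r\downarrow0}\ \sup_{0<s,t<r}\ \arccos\frac{d^2(p,\gamma_p^u(s))+d^2(p,\gamma_p^q(t))-d^2(\gamma_p^u(s),\gamma_p^q(t))}{2\,d(p,\gamma_p^u(s))\,d(p,\gamma_p^q(t))}.$$ Assume that for all $p,q,r,u\in\mathcal M$ with $u\ne p$ $$\bigl|d(p,q)\cos\angle_p(u,q)-d(p,r)\cos\angle_p(u,r)\bigr|\le C\,d(q,r)^{\alpha},$$ where $d(p,q)\cos\angle_p(u,q)$ is read as $0$ if $q=p$. Let $X$ be a random element of $\mathcal M$ with law $P$ and Fréchet mean $\mu^*$ (a minimizer of $\mu\mapsto \mathbb E\,d^2(X,\mu)$), and suppose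 $0<\sigma_X^2=\mathbb E\,d^2(\mu^*,X)<\infty$. For $\beta\in\mathcal M$ put $h(\beta;x,\mu^*)=d(\mu^*,x)\,d(\mu^*,\beta)\cos\angle_{\mu^*}(x,\beta)$ (equal to $0$ if $x=\mu^*$ or $\beta=\mu^*$), assumed $P$-measurable in $x$. In the binary regression model with parameter $\beta$, the pair $(X,Y)\in\mathcal M\times\{0,1\}$ satisfies $X\sim P$ and $$\operatorname{logit}\,\mathbb P(Y=1\mid X)=h(\beta;X,\mu^*).$$ Let $(X_1,Y_1),\dots,(X_n,Y_n)$ be i.i.d. from this model, let $\mathbb E_\beta$ be the corresponding expectation, and let $$R_n=\inf_{\hat\beta_n}\ \sup_{\beta\in\mathcal M}\ \mathbb E_\beta\bigl[d^2(\beta,\hat\beta_n)\bigr]\in[0,\infty],$$ where the infimum is over all measurable estimators $\hat\beta_n=\hat\beta_n((X_1,Y_1),\dots,(X_n,Y_n))\in\mathcal M$. Let $\beta^*\in\mathcal M$ and $D>0$, let $B(\beta^*,\delta)$ be the closed ball of radius $\delta$ around $\beta^*$, and let $N(\epsilon,B(\beta^*,\delta))$ be the least number of closed balls of radius $\epsilon$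 with centers in $B(\beta^*,\delta)$ that cover $B(\beta^*,\delta)$. (a) If there is $\delta_0>0$ such that $N(\epsilon,B(\beta^*,\delta))$ is finite and $$a\Bigl(\frac\delta\epsilon\Bigr)^{D}\le N(\epsilon,B(\beta^*,\delta))\le A\Bigl(\frac\delta\epsilon\Bigr)^{D}\quad\text{for all }0<\delta\le\delta_0,\ \epsilon>0\text{ with }\delta/\epsilon\ge K,$$ then, for all sufficiently large $n$, $$R_n\ \ge\ c\left(\frac{D}{\sigma_X^2\,n}\right)^{1/\alpha}.$$ (b) If there is $\delta_0>0$ such that $N(\epsilon,B(\beta^*,\delta))$ is finite and $$a\Bigl(\frac\delta\epsilon\Bigr)^{D}\le \log N(\epsilon,B(\beta^*,\delta))\le A\Bigl(\frac\delta\epsilon\Bigr)^{D}\quad\text{for all }0<\delta\le\delta_0,\ \epsilon>0\text{ with }\delta/\epsilon\ge K,$$ then, for all sufficiently large $n$, $$R_n\ \ge\ c\left(\frac{1}{\sigma_X^2\,n}\right)^{1/\alpha}.$$ -/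

import Mathlib

open MeasureTheory Filter Topology
open scoped ENNReal NNReal

noncomputable section

namespace MetricBinaryRegression

/-- `γ`, restricted to `[0, d(p,q)]`, is a geodesic connecting `p` and `q`
(values of `γ` outside this interval play no role). -/
structure IsGeodesic {M : Type*} [MetricSpace M] (p q : M) (γ : ℝ → M) : Prop where
  source : γ 0 = p
  target : γ (dist p q) = q
  isometry : ∀ s ∈ Set.Icc 0 (dist p q), ∀ t ∈ Set.Icc 0 (dist p q),
    dist (γ s) (γ t) = |s - t|

/-- Every two points are connected by a geodesic, and this geodesic is unique. -/
def UniquelyGeodesic (M : Type*) [MetricSpace M] : Prop :=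
  ∀ p q : M, (∃ γ : ℝ → M, IsGeodesic p q γ) ∧
    ∀ γ η : ℝ → M, IsGeodesic p q γ → IsGeodesic p q η → Set.EqOn γ η (Set.Icc 0 (dist p q))

open Classical in
/-- The geodesic from `p` to `q`. In a uniquely geodesic space its restriction to `[0, d(p,q)]`
is the unique one; where no geodesic exists it is a constant map. -/
def geod {M : Type*} [MetricSpace M] (p q : M) : ℝ → M :=
  if h : ∃ γ : ℝ → M, IsGeodesic p q γ then h.choose else fun _ => p

/-- The comparison angle at `p` between `q` and `r` (for distinct points). -/
def comparisonAngle {M : Type*} [MetricSpace M] (p q r : M) : ℝ :=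
  Real.arccos ((dist p q ^ 2 + dist p r ^ 2 - dist q r ^ 2) / (2 * dist p q * dist p r))

/-- The Alexandrov angle at `p` between the geodesics from `p` to `q` and from `p` to `r`,
for `q ≠ p` and `r ≠ p`: the limit, as `ρ → 0`, of the supremum of the comparison angles
at `p` between `γ s` and `η t` over `0 < s, t < ρ`. -/
def alexAngle {M : Type*} [MetricSpace M] (p q r : M) : ℝ :=
  limsup (fun st : ℝ × ℝ => comparisonAngle p (geod p q st.1) (geod p r st.2))
    (𝓝[>] (0 : ℝ) ×ˢ 𝓝[>] (0 : ℝ))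

/-- The Alexandrov inner product
`h(β; x, μ) = d(μ, x) d(μ, β) cos ∠_μ(x, β)`; it is `0` if `x = μ` or `β = μ`. -/
def alexInner {M : Type*} [MetricSpace M] (β x μ : M) : ℝ :=
  dist μ x * dist μ β * Real.cos (alexAngle μ x β)

/-- The Hölder-type regularity of the projections `d(p, q) cos ∠_p(u, q)` in `q`. The angle at `p`
has no meaning for `u = p`; for `q = p` the projection is `0`. -/
def ProjectionHolder (M : Type*) [MetricSpace M] (C α : ℝ) : Prop :=
  ∀ p q r u : M, u ≠ p →
    |dist p q * Real.cos (alexAngle p u q) - dist p r * Real.cos (alexAngle p u r)|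
      ≤ C * dist q r ^ α

/-- `μ` minimizes `ν ↦ E d²(X, ν)`, where `X` has law `P`. -/
def IsFrechetMean {M : Type*} [MetricSpace M] [MeasurableSpace M] (P : Measure M) (μ : M) : Prop :=
  ∀ ν : M, ∫⁻ x, ENNReal.ofReal (dist x μ ^ 2) ∂P ≤ ∫⁻ x, ENNReal.ofReal (dist x ν ^ 2) ∂P

/-- `E d²(μ, X)`, where `X` has law `P`. -/
def variance {M : Type*} [MetricSpace M] [MeasurableSpace M] (P : Measure M) (μ : M) : ℝ :=
  ∫ x, dist μ x ^ 2 ∂P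

/-- The conditional probability of the response `y` (`true` stands for `1`, `false` for `0`) given
`X = x`, when the log odds of `y = 1` are `h(β; x, μ)`. -/
def responseProb {M : Type*} [MetricSpace M] (μ β x : M) (y : Bool) : ℝ :=
  if y then Real.sigmoid (alexInner β x μ) else 1 - Real.sigmoid (alexInner β x μ)

/-- The joint law of `(X, Y)` in the binary regression model: `X` has law `P`, and
`logit P(Y = 1 | X) = h(β; X, μ)`. -/
def modelLaw {M : Type*} [MetricSpace M] [MeasurableSpace M] (P : Measure M) (μ β : M) :
    Measure (M × Bool) :=
  (P.prod Measure.count).withDensity fun z => ENNReal.ofReal (responseProb μ β z.1 z.2)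

/-- The minimax risk for squared distance, from `n` independent observations of the model: the
infimum over all (measurable) estimators of the supremum over `β` of `E_β d²(β, b)`. -/
def minimaxRisk {M : Type*} [MetricSpace M] [MeasurableSpace M] (P : Measure M) (μ : M) (n : ℕ) :
    ℝ≥0∞ :=
  ⨅ (b : (Fin n → M × Bool) → M) (_ : Measurable b),
    ⨆ β : M, ∫⁻ z, ENNReal.ofReal (dist β (b z) ^ 2) ∂(Measure.pi fun _ : Fin n => modelLaw P μ β)

/-- The covering number of the closed ball of radius `δ` around `β` by closed balls of radius `ε`
with centers in it. -/
def localCovering {M : Type*} [MetricSpace M] (β : M) (δ ε : ℝ) : ℕ∞ :=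
  Metric.coveringNumber ε.toNNReal (Metric.closedBall β δ)

/-- `N(ε, B(β, δ)) ≍ (δ/ε)^D`, with constants `a` and `A`, for all small `δ` and all
`δ/ε ≥ K`. -/
def LogPolynomialEntropy {M : Type*} [MetricSpace M] (β : M) (D a A K : ℝ) : Prop :=
  ∃ δ₀ > 0, ∀ δ ε : ℝ, 0 < δ → δ ≤ δ₀ → 0 < ε → K ≤ δ / ε →
    localCovering β δ ε ≠ ⊤ ∧
    a * (δ / ε) ^ D ≤ ((localCovering β δ ε).toNat : ℝ) ∧
    ((localCovering β δ ε).toNat : ℝ) ≤ A * (δ / ε) ^ D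

/-- `log N(ε, B(β, δ)) ≍ (δ/ε)^D`, with constants `a` and `A`, for all small `δ` and all
`δ/ε ≥ K`. -/
def PolynomialEntropy {M : Type*} [MetricSpace M] (β : M) (D a A K : ℝ) : Prop :=
  ∃ δ₀ > 0, ∀ δ ε : ℝ, 0 < δ → δ ≤ δ₀ → 0 < ε → K ≤ δ / ε →
    localCovering β δ ε ≠ ⊤ ∧
    a * (δ / ε) ^ D ≤ Real.log ((localCovering β δ ε).toNat : ℝ) ∧
    Real.log ((localCovering β δ ε).toNat : ℝ) ≤ A * (δ / ε) ^ D

end MetricBinaryRegression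

end

open MetricBinaryRegression

/-!
Two logistic regressions with log odds `f` and `g` have Kullback-Leibler divergence at most
`E (f - g)² / 4`. By the Hölder condition, the model laws at parameters within distance `ρ` of each
other therefore have divergence at most `(C ρ ^ α)² σ² / 4`, which is multiplied by `n` for `n`
observations. By Fano's inequality, no estimator can tell apart `N` such parameters if
`n (C ρ ^ α)² σ² ≤ log N`, so their separation bounds the risk from below; it suffices that it is a
fixed fraction of `ρ`.

For the parametric rate, `16` equispaced points of a short geodesic are such parameters. A gain of
the factor `D` needs `log N ≥ D`. As the constant may depend on `a`, the geodesic still provides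
enough points while `exp D` is bounded in terms of `1 / a`; for larger `D`, balls of radius `δ / k`
with `k ≥ e²` give `N ≥ a k ^ D ≥ a exp (2 D) ≥ exp D`.
-/

namespace MetricBinaryRegression

open InformationTheory ProbabilityTheory

section KLDivergence

variable {X Y : Type*} [MeasurableSpace X] [MeasurableSpace Y]

lemma klDiv_map_measurableEquiv (e : X ≃ᵐ Y) (μ ν : Measure X) [IsFiniteMeasure μ]
    [IsFiniteMeasure ν] : klDiv (μ.map e) (ν.map e) = klDiv μ ν := by
  refine (klDiv_map_le _ _ e.measurable).antisymm ?_
  simpa [Measure.map_map e.symm.measurable e.measurable] using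
    klDiv_map_le (μ.map e) (ν.map e) e.symm.measurable

lemma klDiv_prod (μ ν : Measure X) (μ' ν' : Measure Y) [IsProbabilityMeasure μ]
    [IsProbabilityMeasure ν] [IsProbabilityMeasure μ'] [IsProbabilityMeasure ν'] :
    klDiv (μ.prod μ') (ν.prod ν') = klDiv μ ν + klDiv μ' ν' := by
  have h_swap : klDiv (μ.prod μ') (μ.prod ν') = klDiv (μ'.prod μ) (ν'.prod μ) := by
    rw [← Measure.prod_swap, ← Measure.prod_swap (μ := ν')]
    exact klDiv_map_measurableEquiv MeasurableEquiv.prodComm _ _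
  calc klDiv (μ.prod μ') (ν.prod ν')
      = klDiv μ ν + klDiv (μ.prod μ') (μ.prod ν') := by
        simpa only [Measure.compProd_const] using
          klDiv_compProd_eq_add μ ν (Kernel.const X μ') (Kernel.const X ν')
    _ = klDiv μ ν + klDiv μ' ν' := by
        rw [h_swap]
        simpa only [Measure.compProd_const] using
          congrArg (klDiv μ ν + ·) (klDiv_compProd_left μ' ν' (Kernel.const Y μ))

lemma klDiv_pi_const (μ ν : Measure X) [IsProbabilityMeasure μ] [IsProbabilityMeasure ν] (n : ℕ) :
    klDiv (Measure.pi fun _ : Fin n => μ) (Measure.pi fun _ : Fin n => ν) = n * klDiv μ ν := by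
  induction n with
  | zero =>
    rw [Measure.pi_of_empty (fun _ => μ) Fin.elim0, Measure.pi_of_empty (fun _ => ν) Fin.elim0,
      klDiv_self, Nat.cast_zero, zero_mul]
  | succ n ih =>
    have e (ρ : Measure X) [IsProbabilityMeasure ρ] :=
      (measurePreserving_piFinSuccAbove (fun _ : Fin (n + 1) => ρ) 0).map_eq
    rw [← klDiv_map_measurableEquiv (MeasurableEquiv.piFinSuccAbove (fun _ => X) 0), e μ, e ν,
      klDiv_prod, ih]
    push_cast
    ring

lemma integral_le_toReal_klDiv_add_log {μ ν : Measure X} [IsProbabilityMeasure μ]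
    [IsProbabilityMeasure ν] (h : klDiv μ ν ≠ ∞) {f : X → ℝ} (hf : Integrable f μ)
    (hexp : Integrable (fun x => Real.exp (f x)) ν) :
    ∫ x, f x ∂μ ≤ (klDiv μ ν).toReal + Real.log (∫ x, Real.exp (f x) ∂ν) := by
  obtain ⟨hac, hllr⟩ := klDiv_ne_top_iff.mp h
  have : IsProbabilityMeasure (ν.tilted f) := isProbabilityMeasure_tilted hexp
  -- The Gibbs inequality for `μ` against the tilted measure `exp f • ν / ∫ exp f ∂ν`.
  have h_gibbs := integral_llr_add_sub_measure_univ_nonneg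
    (hac.trans (absolutelyContinuous_tilted hexp)) (integrable_llr_tilted_right hac hf hllr hexp)
  rw [integral_llr_tilted_right hac hf hexp hllr] at h_gibbs
  rw [toReal_klDiv_of_measure_eq hac (by simp)]
  simp only [probReal_univ] at h_gibbs
  linarith

lemma mul_measureReal_le_toReal_klDiv_add_log {μ ν : Measure X} [IsProbabilityMeasure μ]
    [IsProbabilityMeasure ν] (h : klDiv μ ν ≠ ∞) {A : Set X} (hA : MeasurableSet A) (s : ℝ) :
    s * μ.real A ≤ (klDiv μ ν).toReal + Real.log (1 + (Real.exp s - 1) * ν.real A) := by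
  have h_exp : (fun x => Real.exp (A.indicator (fun _ => s) x)) =
      fun x => 1 + A.indicator (fun _ => Real.exp s - 1) x := by
    funext x
    by_cases hx : x ∈ A <;> simp [hx]
  have h_ind (ρ : Measure X) [IsFiniteMeasure ρ] (c : ℝ) :
      Integrable (A.indicator fun _ => c) ρ :=
    (integrable_const c).indicator hA
  have h_dv := integral_le_toReal_klDiv_add_log h (h_ind μ s)
    (h_exp ▸ (integrable_const 1).add (h_ind ν _))
  rw [h_exp, integral_add (integrable_const 1) (h_ind ν _)] at h_dv
  simpa [integral_indicator_const, hA, mul_comm] using h_dv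

end KLDivergence

section Fano

variable {Ω ι : Type*} [MeasurableSpace Ω] [Fintype ι]
  {Q : ι → Measure Ω} [∀ i, IsProbabilityMeasure (Q i)]

open Fintype (card)

lemma exists_measureReal_le_inv_card [Nonempty ι] (ν : Measure Ω) [IsProbabilityMeasure ν]
    {A : ι → Set Ω} (hA : ∀ i, MeasurableSet (A i)) (hdisj : Pairwise (Function.onFun Disjoint A)) :
    ∃ i, ν.real (A i) ≤ (card ι : ℝ)⁻¹ := by
  have h_sum : ∑ i, ν.real (A i) ≤ ∑ _i : ι, (card ι : ℝ)⁻¹ := by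
    rw [← measureReal_iUnion_fintype hdisj hA]
    simp [measureReal_le_one]
  obtain ⟨i, -, hi⟩ := Finset.exists_le_of_sum_le Finset.univ_nonempty h_sum
  exact ⟨i, hi⟩

lemma exists_measureReal_mul_log_card_le [Nonempty ι] {ν : Measure Ω} [IsProbabilityMeasure ν]
    {κ : ℝ} (hκ : 0 ≤ κ) (hQ : ∀ i, klDiv (Q i) ν ≤ ENNReal.ofReal κ) {A : ι → Set Ω}
    (hA : ∀ i, MeasurableSet (A i)) (hdisj : Pairwise (Function.onFun Disjoint A)) :
    ∃ i, (Q i).real (A i) * Real.log (card ι) ≤ κ + Real.log 2 := by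
  have hcard : (1 : ℝ) ≤ card ι := by exact_mod_cast Fintype.card_pos
  obtain ⟨i, hi⟩ := exists_measureReal_le_inv_card ν hA hdisj
  have h_dv := mul_measureReal_le_toReal_klDiv_add_log
    (ne_top_of_le_ne_top ENNReal.ofReal_ne_top (hQ i)) (hA i) (Real.log (card ι))
  rw [Real.exp_log (by linarith)] at h_dv
  have h_nonneg : 0 ≤ (card ι - 1) * ν.real (A i) :=
    mul_nonneg (sub_nonneg.mpr hcard) measureReal_nonneg
  have h_le_one : (card ι - 1) * ν.real (A i) ≤ 1 :=
    calc (card ι - 1) * ν.real (A i) ≤ card ι * (card ι : ℝ)⁻¹ := by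
          gcongr
          linarith
      _ = 1 := mul_inv_cancel₀ (by linarith)
  refine ⟨i, ?_⟩
  calc (Q i).real (A i) * Real.log (card ι)
      ≤ (klDiv (Q i) ν).toReal + Real.log (1 + (card ι - 1) * ν.real (A i)) := by
        rwa [mul_comm]
    _ ≤ κ + Real.log 2 :=
        add_le_add (ENNReal.toReal_le_of_le_ofReal hκ (hQ i))
          (Real.log_le_log (by linarith) (by linarith))

lemma exists_half_le_measureReal_compl (hcard : 16 ≤ card ι)
    (hQ : ∀ i j, klDiv (Q i) (Q j) ≤ ENNReal.ofReal (Real.log (card ι) / 4)) {A : ι → Set Ω}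
    (hA : ∀ i, MeasurableSet (A i)) (hdisj : Pairwise (Function.onFun Disjoint A)) :
    ∃ i, 1 / 2 ≤ (Q i).real (A i)ᶜ := by
  have h_log : 4 * Real.log 2 ≤ Real.log (card ι) := by
    rw [← Real.log_rpow two_pos]
    exact Real.log_le_log (by positivity) (by norm_num; exact_mod_cast hcard)
  have h_log2 := Real.log_pos one_lt_two
  obtain ⟨j⟩ : Nonempty ι := Fintype.card_pos_iff.mp (by omega)
  have : Nonempty ι := ⟨j⟩
  obtain ⟨i, hi⟩ := exists_measureReal_mul_log_card_le (by linarith) (hQ · j) hA hdisj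
  refine ⟨i, ?_⟩
  rw [probReal_compl_eq_one_sub (hA i)]
  have : (Q i).real (A i) ≤ 1 / 2 := by nlinarith
  linarith

lemma exists_le_lintegral_dist_sq {M : Type*} [PseudoMetricSpace M] [MeasurableSpace M]
    [OpensMeasurableSpace M] {θ : ι → M} {ε : ℝ} (hε : 0 ≤ ε)
    (hθ : Pairwise fun i j => ε ≤ dist (θ i) (θ j)) (hcard : 16 ≤ card ι)
    (hQ : ∀ i j, klDiv (Q i) (Q j) ≤ ENNReal.ofReal (Real.log (card ι) / 4)) {b : Ω → M}
    (hb : Measurable b) :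
    ∃ i, ENNReal.ofReal (ε ^ 2 / 8) ≤ ∫⁻ z, ENNReal.ofReal (dist (θ i) (b z) ^ 2) ∂Q i := by
  have h_meas (i : ι) : MeasurableSet (b ⁻¹' Metric.ball (θ i) (ε / 2)) :=
    hb Metric.isOpen_ball.measurableSet
  have h_disj : Pairwise (Function.onFun Disjoint fun i => b ⁻¹' Metric.ball (θ i) (ε / 2)) :=
    fun i j hij => (Metric.ball_disjoint_ball (by linarith [hθ hij])).preimage b
  obtain ⟨i, hi⟩ := exists_half_le_measureReal_compl hcard hQ h_meas h_disj
  refine ⟨i, ?_⟩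
  have h_subset : (b ⁻¹' Metric.ball (θ i) (ε / 2))ᶜ ⊆
      {z | ENNReal.ofReal ((ε / 2) ^ 2) ≤ ENNReal.ofReal (dist (θ i) (b z) ^ 2)} := by
    intro z hz
    have : ε / 2 ≤ dist (θ i) (b z) := by simpa [dist_comm] using hz
    exact ENNReal.ofReal_le_ofReal (by gcongr)
  calc ENNReal.ofReal (ε ^ 2 / 8)
      = ENNReal.ofReal ((ε / 2) ^ 2) * ENNReal.ofReal (1 / 2) := by
        rw [← ENNReal.ofReal_mul (by positivity)]
        ring_nf
    _ ≤ ENNReal.ofReal ((ε / 2) ^ 2) * Q i (b ⁻¹' Metric.ball (θ i) (ε / 2))ᶜ := by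
        gcongr
        exact ENNReal.ofReal_le_of_le_toReal hi
    _ ≤ ∫⁻ z, ENNReal.ofReal (dist (θ i) (b z) ^ 2) ∂Q i :=
        (mul_le_mul_right (measure_mono h_subset) _).trans
          (mul_meas_ge_le_lintegral (by fun_prop) _)

end Fano

lemma klDiv_withDensity_ofReal {X : Type*} [MeasurableSpace X] {ρ : Measure X}
    {p q : X → ℝ} (hp : AEMeasurable p ρ) (hq : AEMeasurable q ρ) (hp0 : ∀ x, 0 ≤ p x)
    (hq0 : ∀ x, 0 < q x) [IsFiniteMeasure (ρ.withDensity fun x => ENNReal.ofReal (p x))]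
    [IsFiniteMeasure (ρ.withDensity fun x => ENNReal.ofReal (q x))] :
    klDiv (ρ.withDensity fun x => ENNReal.ofReal (p x))
        (ρ.withDensity fun x => ENNReal.ofReal (q x)) =
      ∫⁻ x, ENNReal.ofReal (q x * klFun (p x / q x)) ∂ρ := by
  set ν := ρ.withDensity fun x => ENNReal.ofReal (q x) with hν
  have h_ac : ν ≪ ρ := withDensity_absolutelyContinuous _ _
  have h_ratio : AEMeasurable (fun x => p x / q x) ρ := hp.div hq
  have h_eq : ρ.withDensity (fun x => ENNReal.ofReal (p x)) =
      ν.withDensity fun x => ENNReal.ofReal (p x / q x) := by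
    rw [hν, ← withDensity_mul₀ hq.ennreal_ofReal h_ratio.ennreal_ofReal]
    congr with x
    rw [Pi.mul_apply, ← ENNReal.ofReal_mul (hq0 x).le, mul_div_cancel₀ _ (hq0 x).ne']
  have h_rnDeriv : ∀ᵐ x ∂ν,
      klFun ((ν.withDensity fun x => ENNReal.ofReal (p x / q x)).rnDeriv ν x).toReal =
        klFun (p x / q x) := by
    filter_upwards [Measure.rnDeriv_withDensity₀ ν (h_ratio.mono_ac h_ac).ennreal_ofReal] with x hx
    rw [hx, ENNReal.toReal_ofReal (div_nonneg (hp0 x) (hq0 x).le)]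
  have : IsFiniteMeasure (ν.withDensity fun x => ENNReal.ofReal (p x / q x)) := by
    rwa [← h_eq]
  rw [h_eq, klDiv_eq_lintegral_klFun_of_ac (withDensity_absolutelyContinuous _ _),
    lintegral_congr_ae (h_rnDeriv.mono fun x hx => congrArg ENNReal.ofReal hx), hν,
    lintegral_withDensity_eq_lintegral_mul₀ hq.ennreal_ofReal (by fun_prop)]
  exact lintegral_congr fun x => (ENNReal.ofReal_mul (hq0 x).le).symm

section Logistic

lemma abs_sigmoid_sub_le (s t : ℝ) : |Real.sigmoid s - Real.sigmoid t| ≤ |s - t| / 4 := by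
  have h_lip : LipschitzWith 4⁻¹ Real.sigmoid := by
    refine lipschitzWith_of_nnnorm_deriv_le differentiable_sigmoid fun x => ?_
    rw [← NNReal.coe_le_coe, coe_nnnorm, Real.deriv_sigmoid, Real.norm_of_nonneg
      (mul_nonneg (Real.sigmoid_nonneg x) (sub_nonneg.mpr (Real.sigmoid_le_one x)))]
    push_cast
    linarith [sq_nonneg (Real.sigmoid x - 1 / 2)]
  simpa [Real.dist_eq, div_eq_inv_mul] using h_lip.dist_le_mul s t

lemma log_sigmoid_sub_log_one_sub_sigmoid (t : ℝ) :
    Real.log (Real.sigmoid t) - Real.log (1 - Real.sigmoid t) = t := by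
  rw [← Real.sigmoid_neg, ← Real.sigmoid_mul_rexp_neg,
    Real.log_mul (Real.sigmoid_pos t).ne' (Real.exp_pos _).ne', Real.log_exp]
  ring

/-- The probability of the response `y` (`true` stands for `1`, `false` for `0`) when the log odds
of `y = 1` are `t`. -/
noncomputable def logisticProb (t : ℝ) (y : Bool) : ℝ :=
  if y then Real.sigmoid t else 1 - Real.sigmoid t

lemma logisticProb_pos (t : ℝ) (y : Bool) : 0 < logisticProb t y := by
  cases y
  · simpa [logisticProb] using Real.sigmoid_lt_one t
  · simpa [logisticProb] using Real.sigmoid_pos t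

lemma sum_logisticProb (t : ℝ) : ∑ y, logisticProb t y = 1 := by
  simp [logisticProb]

lemma measurable_logisticProb : Measurable fun z : ℝ × Bool => logisticProb z.1 z.2 :=
  measurable_from_prod_countable_left fun y => by
    cases y <;> simpa [logisticProb] using by fun_prop

lemma mul_klFun_div {p q : ℝ} (hp : 0 < p) (hq : 0 < q) :
    q * klFun (p / q) = p * (Real.log p - Real.log q) + (q - p) := by
  rw [klFun_apply, Real.log_div hp.ne' hq.ne']
  field_simp
  ring

lemma sum_mul_klFun_logisticProb_le (s t : ℝ) :
    ∑ y, logisticProb t y * klFun (logisticProb s y / logisticProb t y) ≤ (s - t) ^ 2 / 4 := by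
  -- In the symmetrized divergence the logarithms combine to the difference of the log odds.
  have h_symm : ∑ y, logisticProb t y * klFun (logisticProb s y / logisticProb t y) +
      ∑ y, logisticProb s y * klFun (logisticProb t y / logisticProb s y) =
        (Real.sigmoid s - Real.sigmoid t) * (s - t) := by
    simp only [mul_klFun_div (logisticProb_pos _ _) (logisticProb_pos _ _), Fintype.sum_bool]
    simp only [logisticProb, if_true, Bool.false_eq_true, if_false]
    linear_combination (Real.sigmoid s - Real.sigmoid t) * (log_sigmoid_sub_log_one_sub_sigmoid s
      - log_sigmoid_sub_log_one_sub_sigmoid t)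
  have h_nonneg : 0 ≤ ∑ y, logisticProb s y * klFun (logisticProb t y / logisticProb s y) :=
    Finset.sum_nonneg fun y _ => mul_nonneg (logisticProb_pos s y).le
      (klFun_nonneg (div_pos (logisticProb_pos t y) (logisticProb_pos s y)).le)
  calc ∑ y, logisticProb t y * klFun (logisticProb s y / logisticProb t y)
      ≤ (Real.sigmoid s - Real.sigmoid t) * (s - t) := by linarith
    _ ≤ |s - t| / 4 * |s - t| := (le_abs_self _).trans <| by
        rw [abs_mul]
        gcongr
        exact abs_sigmoid_sub_le s t
    _ = (s - t) ^ 2 / 4 := by rw [← sq_abs (s - t)]; ring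

variable {X : Type*} [MeasurableSpace X] {P : Measure X} {f g h : X → ℝ}

/-- The joint law of `(X, Y)` in the logistic regression model: `X` has law `P`, and the
conditional log odds of `Y = 1` given `X` are `h X`. The density is taken with respect to the
product of `P` and the counting measure on `Bool`. -/
noncomputable def logisticLaw (P : Measure X) (h : X → ℝ) : Measure (X × Bool) :=
  (P.prod Measure.count).withDensity fun z => ENNReal.ofReal (logisticProb (h z.1) z.2)

lemma aemeasurable_logisticProb_comp (hh : AEMeasurable h P) :
    AEMeasurable (fun z : X × Bool => logisticProb (h z.1) z.2) (P.prod Measure.count) :=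
  measurable_logisticProb.comp_aemeasurable (hh.comp_fst.prodMk measurable_snd.aemeasurable)

lemma lintegral_prod_count_ofReal {Y : Type*} [Fintype Y] [MeasurableSpace Y]
    [MeasurableSingletonClass Y] {F : X × Y → ℝ}
    (hF : AEMeasurable F (P.prod Measure.count)) (hF0 : ∀ z, 0 ≤ F z) :
    ∫⁻ z, ENNReal.ofReal (F z) ∂(P.prod Measure.count) =
      ∫⁻ x, ENNReal.ofReal (∑ y, F (x, y)) ∂P := by
  rw [lintegral_prod _ hF.ennreal_ofReal]
  refine lintegral_congr fun x => ?_
  rw [lintegral_count, tsum_fintype, ENNReal.ofReal_sum_of_nonneg fun y _ => hF0 (x, y)]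

lemma isProbabilityMeasure_logisticLaw [IsProbabilityMeasure P] (hh : AEMeasurable h P) :
    IsProbabilityMeasure (logisticLaw P h) := by
  refine ⟨?_⟩
  rw [logisticLaw, withDensity_apply _ .univ, setLIntegral_univ,
    lintegral_prod_count_ofReal (aemeasurable_logisticProb_comp hh)
      fun z => (logisticProb_pos _ _).le]
  simp [-Fintype.univ_bool, sum_logisticProb]

lemma klDiv_logisticLaw_le [IsProbabilityMeasure P] (hf : AEMeasurable f P)
    (hg : AEMeasurable g P) :
    klDiv (logisticLaw P f) (logisticLaw P g) ≤ ∫⁻ x, ENNReal.ofReal ((f x - g x) ^ 2 / 4) ∂P := by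
  have hf_meas := aemeasurable_logisticProb_comp hf
  have hg_meas := aemeasurable_logisticProb_comp hg
  have := isProbabilityMeasure_logisticLaw hf
  have := isProbabilityMeasure_logisticLaw hg
  unfold logisticLaw at *
  rw [klDiv_withDensity_ofReal hf_meas hg_meas (fun z => (logisticProb_pos _ _).le)
      (fun z => logisticProb_pos _ _),
    lintegral_prod_count_ofReal (by fun_prop) fun z => mul_nonneg (logisticProb_pos _ _).le
      (klFun_nonneg (div_pos (logisticProb_pos _ _) (logisticProb_pos _ _)).le)]
  exact lintegral_mono fun x =>
    ENNReal.ofReal_le_ofReal (sum_mul_klFun_logisticProb_le (f x) (g x))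

end Logistic

section Model

variable {M : Type*} [MetricSpace M] {C α : ℝ}

lemma abs_alexInner_sub_le (hproj : ProjectionHolder M C α) (μ β β' x : M) :
    |alexInner β x μ - alexInner β' x μ| ≤ dist μ x * (C * dist β β' ^ α) := by
  rcases eq_or_ne x μ with rfl | hx
  · simp [alexInner]
  · simp only [alexInner, mul_assoc, ← mul_sub]
    rw [abs_mul, abs_of_nonneg dist_nonneg]
    gcongr
    exact hproj μ β β' x hx

variable [MeasurableSpace M] {P : Measure M} {μ : M}

lemma modelLaw_eq_logisticLaw (P : Measure M) (μ β : M) :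
    modelLaw P μ β = logisticLaw P fun x => alexInner β x μ :=
  rfl

variable [IsProbabilityMeasure P]

lemma klDiv_modelLaw_le (hproj : ProjectionHolder M C α)
    (hint : Integrable (fun x => dist μ x ^ 2) P) {β β' : M}
    (hβ : AEMeasurable (fun x => alexInner β x μ) P)
    (hβ' : AEMeasurable (fun x => alexInner β' x μ) P) :
    klDiv (modelLaw P μ β) (modelLaw P μ β') ≤
      ENNReal.ofReal ((C * dist β β' ^ α) ^ 2 * variance P μ / 4) := by
  have h_sq (x : M) : (alexInner β x μ - alexInner β' x μ) ^ 2 / 4 ≤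
      (C * dist β β' ^ α) ^ 2 / 4 * dist μ x ^ 2 := by
    have := sq_le_sq' (neg_le_of_abs_le (abs_alexInner_sub_le hproj μ β β' x))
      (le_of_abs_le (abs_alexInner_sub_le hproj μ β β' x))
    linarith
  calc klDiv (modelLaw P μ β) (modelLaw P μ β')
      ≤ ∫⁻ x, ENNReal.ofReal ((alexInner β x μ - alexInner β' x μ) ^ 2 / 4) ∂P := by
        simpa only [modelLaw_eq_logisticLaw] using klDiv_logisticLaw_le hβ hβ'
    _ ≤ ∫⁻ x, ENNReal.ofReal ((C * dist β β' ^ α) ^ 2 / 4 * dist μ x ^ 2) ∂P :=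
        lintegral_mono fun x => ENNReal.ofReal_le_ofReal (h_sq x)
    _ = ENNReal.ofReal ((C * dist β β' ^ α) ^ 2 * variance P μ / 4) := by
        rw [← ofReal_integral_eq_lintegral_ofReal (hint.const_mul _)
          (.of_forall fun x => by positivity), integral_const_mul, variance, div_mul_eq_mul_div]

lemma le_minimaxRisk_of_separated [OpensMeasurableSpace M] (hC : 0 ≤ C) (hα : 0 ≤ α)
    (hproj : ProjectionHolder M C α) (hint : Integrable (fun x => dist μ x ^ 2) P)
    (hmeas : ∀ β : M, AEMeasurable (fun x => alexInner β x μ) P) {ι : Type*} [Fintype ι]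
    (hcard : 16 ≤ Fintype.card ι) {θ : ι → M} {ε ρ : ℝ} (hε : 0 ≤ ε)
    (hsep : Pairwise fun i j => ε ≤ dist (θ i) (θ j)) (hdiam : ∀ i j, dist (θ i) (θ j) ≤ ρ) {n : ℕ}
    (hn : n * ((C * ρ ^ α) ^ 2 * variance P μ) ≤ Real.log (Fintype.card ι)) :
    ENNReal.ofReal (ε ^ 2 / 8) ≤ minimaxRisk P μ n := by
  have (β : M) : IsProbabilityMeasure (modelLaw P μ β) :=
    modelLaw_eq_logisticLaw P μ β ▸ isProbabilityMeasure_logisticLaw (hmeas β)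
  have h_variance : 0 ≤ variance P μ := integral_nonneg fun x => sq_nonneg _
  have h_kl (i j : ι) : klDiv (Measure.pi fun _ : Fin n => modelLaw P μ (θ i))
      (Measure.pi fun _ : Fin n => modelLaw P μ (θ j)) ≤
        ENNReal.ofReal (Real.log (Fintype.card ι) / 4) := by
    calc klDiv (Measure.pi fun _ : Fin n => modelLaw P μ (θ i))
          (Measure.pi fun _ : Fin n => modelLaw P μ (θ j))
        = n * klDiv (modelLaw P μ (θ i)) (modelLaw P μ (θ j)) := klDiv_pi_const _ _ n
      _ ≤ ENNReal.ofReal n * ENNReal.ofReal ((C * ρ ^ α) ^ 2 * variance P μ / 4) := by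
          rw [ENNReal.ofReal_natCast]
          gcongr
          refine (klDiv_modelLaw_le hproj hint (hmeas _) (hmeas _)).trans
            (ENNReal.ofReal_le_ofReal ?_)
          gcongr
          exact hdiam i j
      _ ≤ ENNReal.ofReal (Real.log (Fintype.card ι) / 4) := by
          rw [← ENNReal.ofReal_mul n.cast_nonneg]
          exact ENNReal.ofReal_le_ofReal (by linarith)
  refine le_iInf₂ fun b hb => ?_
  obtain ⟨i, hi⟩ := exists_le_lintegral_dist_sq hε hsep hcard h_kl hb
  exact hi.trans (le_iSup (fun β => ∫⁻ z, ENNReal.ofReal (dist β (b z) ^ 2)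
    ∂(Measure.pi fun _ : Fin n => modelLaw P μ β)) (θ i))

end Model

section CriticalRadius

/-- The critical radius: the radius `ρ` at which `n (C ρ ^ α) ^ 2 v = s`. With `v` the variance of
`X`, parameters at distance at most `ρ` have model laws whose `n`-fold products have
Kullback-Leibler divergence at most `s / 4`. -/
noncomputable def criticalRadius (C α v s : ℝ) (n : ℕ) : ℝ :=
  (s / (C ^ 2 * v * n)) ^ (1 / (2 * α))

variable {C α v s : ℝ} {n : ℕ}

lemma criticalRadius_pos (hC : 0 < C) (hv : 0 < v) (hs : 0 < s) (hn : 0 < n) :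
    0 < criticalRadius C α v s n := by
  unfold criticalRadius
  positivity

lemma mul_sq_criticalRadius_rpow (hC : 0 < C) (hα : 0 < α) (hv : 0 < v) (hs : 0 < s)
    (hn : 0 < n) : n * ((C * criticalRadius C α v s n ^ α) ^ 2 * v) = s := by
  have h_rpow : (criticalRadius C α v s n ^ α) ^ 2 = s / (C ^ 2 * v * n) := by
    rw [criticalRadius, ← Real.rpow_mul_natCast (by positivity), ← Real.rpow_mul (by positivity),
      show 1 / (2 * α) * (α * (2 : ℕ)) = 1 by push_cast; field_simp, Real.rpow_one]
  rw [mul_pow, h_rpow]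
  field_simp

lemma criticalRadius_sq (hα : 0 < α) (hv : 0 < v) (hs : 0 < s) :
    criticalRadius C α v s n ^ 2 = (C ^ 2)⁻¹ ^ (1 / α) * (s / (v * n)) ^ (1 / α) := by
  rw [criticalRadius, ← Real.rpow_mul_natCast (by positivity),
    ← Real.mul_rpow (by positivity) (by positivity),
    show 1 / (2 * α) * (2 : ℕ) = 1 / α by push_cast; field_simp]
  congr 1
  ring

lemma tendsto_criticalRadius (hC : 0 < C) (hα : 0 < α) (hv : 0 < v) (hs : 0 < s) :
    Tendsto (criticalRadius C α v s) atTop (𝓝[>] 0) := by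
  refine tendsto_nhdsWithin_iff.mpr ⟨?_, ?_⟩
  · have h_exponent : 0 < 1 / (2 * α) := by positivity
    have h_tendsto := (tendsto_const_div_atTop_nhds_zero_nat (s / (C ^ 2 * v))).rpow_const
      (p := 1 / (2 * α)) (.inr h_exponent.le)
    simp only [div_div, Real.zero_rpow h_exponent.ne'] at h_tendsto
    exact h_tendsto
  · filter_upwards [eventually_gt_atTop 0] with n hn
    exact criticalRadius_pos hC hv hs hn

end CriticalRadius

section SmallPackings

/-- At every sufficiently small scale `ρ`, the space contains at least `N` points with mutual
distances in `[ρ / B, ρ]`. -/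
def HasSmallPackings (M : Type*) [PseudoMetricSpace M] (N B : ℝ) : Prop :=
  ∀ᶠ ρ in 𝓝[>] (0 : ℝ), ∃ (m : ℕ) (θ : Fin m → M), N ≤ m ∧
    (Pairwise fun i j => ρ / B ≤ dist (θ i) (θ j)) ∧ ∀ i j, dist (θ i) (θ j) ≤ ρ

lemma HasSmallPackings.mono {M : Type*} [PseudoMetricSpace M] {N N' B B' : ℝ}
    (h : HasSmallPackings M N B) (hN : N' ≤ N) (hB : 0 < B) (hBB' : B ≤ B') :
    HasSmallPackings M N' B' := by
  filter_upwards [h, self_mem_nhdsWithin] with ρ ⟨m, θ, hm, hsep, hdiam⟩ (hρ : 0 < ρ)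
  exact ⟨m, θ, hN.trans hm, fun i j hij => (by gcongr : ρ / B' ≤ ρ / B).trans (hsep hij), hdiam⟩

lemma hasSmallPackings_of_isGeodesic {M : Type*} [MetricSpace M] {p q : M} (hpq : p ≠ q)
    {γ : ℝ → M} (hγ : IsGeodesic p q γ) {m : ℕ} (hm : 0 < m) : HasSmallPackings M m m := by
  filter_upwards [Ioc_mem_nhdsGT (dist_pos.mpr hpq)] with ρ ⟨hρ, hρ_le⟩
  have h_mem (i : Fin m) : (i : ℝ) * (ρ / m) ∈ Set.Icc 0 ρ := by
    have hi : (i : ℝ) ≤ m := by exact_mod_cast i.2.le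
    refine ⟨by positivity, ?_⟩
    calc (i : ℝ) * (ρ / m) ≤ m * (ρ / m) := by gcongr
      _ = ρ := by field_simp
  have h_dist (i j : Fin m) :
      dist (γ (i * (ρ / m))) (γ (j * (ρ / m))) = |(i : ℝ) * (ρ / m) - j * (ρ / m)| :=
    hγ.isometry _ (Set.Icc_subset_Icc_right hρ_le (h_mem i)) _
      (Set.Icc_subset_Icc_right hρ_le (h_mem j))
  refine ⟨m, fun i => γ (i * (ρ / m)), le_rfl, fun i j hij => ?_, fun i j => ?_⟩
  · have h_one_le : (1 : ℝ) ≤ |(i : ℝ) - j| := by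
      have : (1 : ℤ) ≤ |(i : ℤ) - j| :=
        Int.one_le_abs (sub_ne_zero.mpr (by exact_mod_cast Fin.val_ne_of_ne hij))
      exact_mod_cast this
    change ρ / m ≤ dist (γ _) (γ _)
    rw [h_dist, ← sub_mul, abs_mul, abs_of_nonneg (by positivity : 0 ≤ ρ / m)]
    exact le_mul_of_one_le_left (by positivity) h_one_le
  · change dist (γ _) (γ _) ≤ ρ
    rw [h_dist, abs_sub_le_iff]
    exact ⟨by linarith [(h_mem i).2, (h_mem j).1], by linarith [(h_mem j).2, (h_mem i).1]⟩

lemma exists_pairwise_lt_edist_of_le_packingNumber {X : Type*} [PseudoEMetricSpace X] {ε : ℝ≥0}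
    {A : Set X} {m : ℕ} (hm : m ≤ Metric.packingNumber ε A) :
    ∃ θ : Fin m → X, (∀ i, θ i ∈ A) ∧ Pairwise fun i j => ε < edist (θ i) (θ j) := by
  obtain ⟨S, hSA, hS, hmS⟩ : ∃ S ⊆ A, Metric.IsSeparated ε S ∧ m ≤ S.encard := by
    rcases m with _ | m
    · exact ⟨∅, Set.empty_subset _, by simp, by simp⟩
    · have h_lt : (m : ℕ∞) < Metric.packingNumber ε A := lt_of_lt_of_le (by norm_cast; omega) hm
      simp only [Metric.packingNumber, lt_iSup_iff] at h_lt
      obtain ⟨S, hSA, hS, hmS⟩ := h_lt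
      exact ⟨S, hSA, hS, by simpa using Order.add_one_le_of_lt hmS⟩
  obtain ⟨T, hTS, hT⟩ := Set.exists_subset_encard_eq hmS
  lift T to Finset X using Set.finite_of_encard_eq_coe hT
  let e := (T.equivFinOfCardEq (by simpa using hT)).symm
  exact ⟨fun i => e i, fun i => hSA (hTS (e i).2), fun i j hij => hS (hTS (e i).2) (hTS (e j).2)
    (Subtype.coe_injective.ne (e.injective.ne hij))⟩

/-- `N(ε, B(β, δ)) ≥ a (δ / ε) ^ D` for all small `δ` and all `δ / ε ≥ K`. The inequality is stated
in `ℝ≥0∞`, so that it also holds if the covering number is infinite. -/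
def CoveringLowerBound {M : Type*} [MetricSpace M] (β : M) (D a K : ℝ) : Prop :=
  ∃ δ₀ > 0, ∀ δ ε : ℝ, 0 < δ → δ ≤ δ₀ → 0 < ε → K ≤ δ / ε →
    ENNReal.ofReal (a * (δ / ε) ^ D) ≤ (localCovering β δ ε : ℝ≥0∞)

variable {M : Type*} [MetricSpace M] {β : M} {D a K : ℝ}

lemma LogPolynomialEntropy.coveringLowerBound {A : ℝ} (h : LogPolynomialEntropy β D a A K) :
    CoveringLowerBound β D a K := by
  obtain ⟨δ₀, hδ₀, h⟩ := h
  refine ⟨δ₀, hδ₀, fun δ ε hδ hδ_le hε hK => ?_⟩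
  obtain ⟨h_fin, h_le, -⟩ := h δ ε hδ hδ_le hε hK
  rw [← ENat.natCast_toNat h_fin, ENat.toENNReal_coe, ← ENNReal.ofReal_natCast]
  exact ENNReal.ofReal_le_ofReal h_le

lemma CoveringLowerBound.hasSmallPackings (h : CoveringLowerBound β D a K) {k : ℝ} (hk : 0 < k)
    (hKk : K ≤ k) : HasSmallPackings M (a * k ^ D) (2 * k) := by
  obtain ⟨δ₀, hδ₀, h⟩ := h
  filter_upwards [Ioc_mem_nhdsGT hδ₀] with ρ ⟨hρ, hρ_le⟩
  have h_ratio : ρ / 2 / (ρ / (2 * k)) = k := by field_simp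
  have h_covering := h (ρ / 2) (ρ / (2 * k)) (by positivity) (by linarith) (by positivity)
    (h_ratio.symm ▸ hKk)
  rw [h_ratio] at h_covering
  have h_ceil : (⌈a * k ^ D⌉₊ : ℕ∞) ≤ localCovering β (ρ / 2) (ρ / (2 * k)) := by
    generalize localCovering β (ρ / 2) (ρ / (2 * k)) = N at h_covering
    induction N with
    | top => exact le_top
    | coe N =>
      rw [ENat.toENNReal_coe, ENNReal.ofReal_le_natCast] at h_covering
      exact_mod_cast Nat.ceil_le.mpr h_covering
  obtain ⟨θ, hθ_mem, hθ_sep⟩ := exists_pairwise_lt_edist_of_le_packingNumber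
    (h_ceil.trans (Metric.coveringNumber_le_packingNumber _ _))
  refine ⟨_, θ, Nat.le_ceil _, fun i j hij => ?_, fun i j => ?_⟩
  · have h_lt : ENNReal.ofReal (ρ / (2 * k)) < edist (θ i) (θ j) := hθ_sep hij
    rw [edist_dist] at h_lt
    exact ((ENNReal.ofReal_lt_ofReal_iff_of_nonneg (by positivity)).mp h_lt).le
  · linarith [dist_triangle_right (θ i) (θ j) β, Metric.mem_closedBall.mp (hθ_mem i),
      Metric.mem_closedBall.mp (hθ_mem j)]

lemma exists_ratio_hasSmallPackings (K : ℝ) (ha : 0 < a) :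
    ∃ B > 0, ∀ (M : Type*) [MetricSpace M] (p q : M) (γ : ℝ → M), p ≠ q → IsGeodesic p q γ →
      HasSmallPackings M 16 B ∧ ∀ (β : M) (D : ℝ), CoveringLowerBound β D a K →
        HasSmallPackings M (max 16 (Real.exp D)) B := by
  obtain ⟨m, hm⟩ := exists_nat_ge (max 16 a⁻¹)
  obtain ⟨h16m, ham⟩ := max_le_iff.mp hm
  have hm_pos : (0 : ℝ) < m := by linarith
  set k := max K (Real.exp 2)
  have hk : 0 < k := (Real.exp_pos 2).trans_le (le_max_right _ _)
  refine ⟨max m (2 * k), by positivity, fun M _ p q γ hpq hγ => ?_⟩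
  have h_geodesic := hasSmallPackings_of_isGeodesic hpq hγ (by exact_mod_cast hm_pos : 0 < m)
  refine ⟨h_geodesic.mono h16m hm_pos (le_max_left _ _), fun β D hβ => ?_⟩
  rcases le_or_gt (Real.exp D) m with hD | hD
  · exact h_geodesic.mono (max_le h16m hD) hm_pos (le_max_left _ _)
  · have hD_pos : 0 < D := Real.one_lt_exp_iff.mp (by linarith)
    have h_exp_le : Real.exp D ≤ a * k ^ D := by
      calc Real.exp D = a * (a⁻¹ * Real.exp D) := by field_simp
        _ ≤ a * (Real.exp D * Real.exp D) := by
            gcongr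
            exact (ham.trans_lt hD).le
        _ = a * Real.exp 2 ^ D := by rw [← Real.exp_add, ← Real.exp_mul]; ring_nf
        _ ≤ a * k ^ D := by
            gcongr
            exact le_max_right _ _
    exact (hβ.hasSmallPackings hk (le_max_left _ _)).mono
      (max_le (h16m.trans (hD.le.trans h_exp_le)) h_exp_le) (by positivity) (le_max_right _ _)

end SmallPackings

section Rate

variable {M : Type*} [MetricSpace M] [MeasurableSpace M] {P : Measure M} {μ : M}

lemma nontrivial_of_variance_pos (hvar : 0 < variance P μ) : Nontrivial M := by
  by_contra h
  rw [not_nontrivial_iff_subsingleton] at h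
  have (x : M) : dist μ x = 0 := dist_eq_zero.mpr (Subsingleton.elim μ x)
  simp [variance, this] at hvar

lemma HasSmallPackings.eventually_le_minimaxRisk [OpensMeasurableSpace M] [IsProbabilityMeasure P]
    {C α s B : ℝ} (hC : 0 < C) (hα : 0 < α) (hproj : ProjectionHolder M C α)
    (hint : Integrable (fun x => dist μ x ^ 2) P) (hvar : 0 < variance P μ)
    (hmeas : ∀ β : M, AEMeasurable (fun x => alexInner β x μ) P) (hs : 0 < s) (hB : 0 < B)
    (hpack : HasSmallPackings M (max 16 (Real.exp s)) B) :
    ∀ᶠ n : ℕ in atTop, ENNReal.ofReal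
      ((C ^ 2)⁻¹ ^ (1 / α) / (8 * B ^ 2) * (s / (variance P μ * n)) ^ (1 / α)) ≤
        minimaxRisk P μ n := by
  filter_upwards [(tendsto_criticalRadius hC hα hvar hs).eventually hpack, eventually_gt_atTop 0]
    with n ⟨m, θ, hm, hsep, hdiam⟩ hn
  obtain ⟨h16, h_exp⟩ := max_le_iff.mp hm
  have h_log : s ≤ Real.log m := (Real.le_log_iff_exp_le (by linarith)).mpr h_exp
  have h_risk := le_minimaxRisk_of_separated (n := n) hC.le hα.le hproj hint hmeas
    (by simpa using (by exact_mod_cast h16 : 16 ≤ m))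
    (div_pos (criticalRadius_pos hC hvar hs hn) hB).le hsep hdiam
    (by simpa [mul_sq_criticalRadius_rpow hC hα hvar hs hn] using h_log)
  rw [div_pow, criticalRadius_sq hα hvar hs] at h_risk
  convert h_risk using 2
  ring

end Rate

end MetricBinaryRegression

theorem mainTheorem2_general (C α a K : ℝ) (hC : 0 < C) (hα : 0 < α) (ha : 0 < a) :
    ∃ c : ℝ, 0 < c ∧
      ∀ (M : Type*) [MetricSpace M] [MeasurableSpace M] [OpensMeasurableSpace M],
        UniquelyGeodesic M → ProjectionHolder M C α →
        ∀ (P : Measure M) [IsProbabilityMeasure P] (μ : M),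
          Integrable (fun x => dist μ x ^ 2) P → 0 < variance P μ →
          (∀ β : M, AEMeasurable (fun x => alexInner β x μ) P) →
          (∀ᶠ n : ℕ in atTop,
            ENNReal.ofReal (c * (1 / (variance P μ * n)) ^ (1 / α)) ≤ minimaxRisk P μ n) ∧
          ∀ (βstar : M) (D : ℝ), 0 < D → CoveringLowerBound βstar D a K →
            ∀ᶠ n : ℕ in atTop,
              ENNReal.ofReal (c * (D / (variance P μ * n)) ^ (1 / α)) ≤ minimaxRisk P μ n := by
  obtain ⟨B, hB, h_pack⟩ := exists_ratio_hasSmallPackings K ha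
  refine ⟨(C ^ 2)⁻¹ ^ (1 / α) / (8 * B ^ 2), by positivity, ?_⟩
  intro M _ _ _ hM hproj P _ μ hint hvar hmeas
  have := nontrivial_of_variance_pos hvar
  obtain ⟨p, q, hpq⟩ := exists_pair_ne M
  obtain ⟨γ, hγ⟩ := (hM p q).1
  obtain ⟨h_pack_geodesic, h_pack_covering⟩ := h_pack M p q γ hpq hγ
  have h_exp_one : max 16 (Real.exp 1) = 16 := max_eq_left (by linarith [Real.exp_one_lt_d9])
  exact ⟨(h_exp_one ▸ h_pack_geodesic).eventually_le_minimaxRisk hC hα hproj hint hvar hmeas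
      one_pos hB,
    fun βstar D hD hβ => (h_pack_covering βstar D hβ).eventually_le_minimaxRisk hC hα hproj hint
      hvar hmeas hD hB⟩

theorem mainTheorem2 (C α a A K : ℝ) (hC : 0 < C) (hα : 0 < α) (hα1 : α ≤ 1)
    (ha : 0 < a) (hA : 0 < A) (hK : 0 < K) :
    ∃ c : ℝ, 0 < c ∧
      ∀ (M : Type*) [MetricSpace M] [CompleteSpace M] [MeasurableSpace M] [BorelSpace M],
        UniquelyGeodesic M → ProjectionHolder M C α →
        ∀ (P : Measure M) [IsProbabilityMeasure P] (μ : M), IsFrechetMean P μ →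
          Integrable (fun x => dist μ x ^ 2) P → 0 < variance P μ →
          (∀ β : M, AEMeasurable (fun x => alexInner β x μ) P) →
          ∀ (βstar : M) (D : ℝ), 0 < D →
            (LogPolynomialEntropy βstar D a A K →
              ∀ᶠ n : ℕ in atTop,
                ENNReal.ofReal (c * (D / (variance P μ * n)) ^ (1 / α)) ≤ minimaxRisk P μ n) ∧
            (PolynomialEntropy βstar D a A K →
              ∀ᶠ n : ℕ in atTop,
                ENNReal.ofReal (c * (1 / (variance P μ * n)) ^ (1 / α)) ≤ minimaxRisk P μ n) := by
  obtain ⟨c, hc, h⟩ := mainTheorem2_general C α a K hC hα ha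
  refine ⟨c, hc, fun M _ _ _ _ hM hproj P _ μ _ hint hvar hmeas βstar D hD => ?_⟩
  obtain ⟨h_parametric, h_covering⟩ := h M hM hproj P μ hint hvar hmeas
  exact ⟨fun hβ => h_covering βstar D hD hβ.coveringLowerBound, fun _ => h_parametric⟩
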